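/- All topological groups are assumed to be $T_1$ (hence Hausdorff and completely regular). An \emph{ideal} on a set $X$ is a non-empty family $\mathcal I\subseteq\mathcal P(X)$ closed under subsets and finite unions; all ideals are assumed to contain every finite subset of $X$, and $\mathcal I^+=\mathcal P(X)\setminus\mathcal I$. For sets, $A\subseteq^* B$ means that $A\setminus B$ is finite. An infinite set $C$ in a topological space \emph{converges} to $x$ (is a convergent sequence) if $C\subseteq^* U$ for every neighbourhood $U$ of $x$. A family $\mathcal J$ of subsets of $X$ is \emph{$\omega$-hitting} if for every countable family $\mathcal Y$ of infinite subsets of $X$ there is a $J\in\mathcal J$ such that $Y\cap J$ is infinite for every $Y\in\mathcal Y$. An ideal $\mathcal I$ on $X$ is \emph{tame} if for every $Y\in\mathcal I^+$, every $f:Y\to\omega$ and every $\omega$-hitting ideal $\mathcal J$ on $\omega$ there is a $J\in\mathcal J$ with $f^{-1}[J]\notin\mathcal I$. An ideal $\mathcal I$ on a group $G$ is \emph{invariant} if $gI$, $Ig$ and $I^{-1}$ belong to $\mathcal I$ for all $I\in\mathcal I$ and $g\in G$. An ideal $\mathcal I$ on a topological group $G$ is \emph{weakly closed} if for every $A\subseteq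 G$ and every infinite $C\subseteq G$ converging to $1_G$ one has $A\in\mathcal I$ if and only if $A\cup\{x\in G: C\cdot x\subseteq^* A\}\in\mathcal I$. A subset $Y$ of a topological space $X$ is \emph{entangled} if for every $x\in X$ the family $\{B\subseteq Y: x\notin\overline{B}\}$ (closure in $X$) is $\omega$-hitting on $Y$. The space $X$ is \emph{groomed} if it has no dense entangled subset. The \emph{Invariant Ideal Axiom} (IIA) is the statement: for every countable groomed topological group $G$ and every tame, weakly closed, invariant ideal $\mathcal I$ on $G$, at least one of the following holds: (1) there is a countable $\mathcal S\subseteq\mathcal I$ such that for every infinite sequence $C$ convergent in $G$ there is an $I\in\mathcal S$ with $C\cap I$ infinite; (2) there is a countable $\mathcal H\subseteq\mathcal I^+$ such that for every non-empty open $U\subseteq G$ there is an $H\in\mathcal H$ with $H\setminus U\in\mathcal I$. A topological space $X$ is \emph{sequential} if every subset that contains the limits of all convergent sequences of its points is closed. It is $k_\omega$ if there is a countable family $\mathcal K$ of compact subspaces of $X$ such that a set $U\subseteq X$ is open in $X$ if and only if $U\cap K$ is relatively open in $K$ for every $K\in\mathcal K$. \textbf{Theorem.} Assume IIA. Then every countable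 sequential topological group is metrizable or $k_\omega$. -/

import Mathlib

open Set Topology

universe u

/-- An infinite set `C` of points converges, as a sequence, to `x`: every neighbourhood of `x`
contains all but finitely many points of `C`. -/
def SeqSetTendsto {X : Type u} [TopologicalSpace X] (C : Set X) (x : X) : Prop :=
  C.Infinite ∧ ∀ U ∈ 𝓝 x, (C \ U).Finite

/-- A `k_ω`-space: the topology is determined by a countable family of compact subspaces. -/
def IsKOmega (X : Type u) [TopologicalSpace X] : Prop :=
  ∃ 𝒦 : Set (Set X), 𝒦.Countable ∧ (∀ K ∈ 𝒦, IsCompact K) ∧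
    ∀ U : Set X, IsOpen U ↔ ∀ K ∈ 𝒦, IsOpen ((Subtype.val : K → X) ⁻¹' U)

/-- A family of subsets of `X` is `ω`-hitting if for every countable family of infinite subsets
of `X` one of its members meets each of them in an infinite set. -/
def OmegaHitting {X : Type u} (𝓘 : Set (Set X)) : Prop :=
  ∀ 𝒴 : Set (Set X), 𝒴.Countable → (∀ Y ∈ 𝒴, Y.Infinite) →
    ∃ I ∈ 𝓘, ∀ Y ∈ 𝒴, (Y ∩ I).Infinite

/-- An ideal of subsets of `X` contains all finite subsets of `X`. -/
def ContainsFinite {X : Type u} (𝓘 : Order.Ideal (Set X)) : Prop :=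
  ∀ F : Set X, F.Finite → F ∈ 𝓘

/-- A subset `Y` of `X` is entangled if for every `x` in `X` the restriction to `Y` of the ideal
`{A | x ∉ closure A}` is `ω`-hitting (as a family of subsets of `Y`). -/
def Entangled {X : Type u} [TopologicalSpace X] (Y : Set X) : Prop :=
  ∀ x : X, OmegaHitting {B : Set Y | x ∉ closure ((Subtype.val : Y → X) '' B)}

/-- A space is groomed if it has no dense entangled subset. -/
def Groomed (X : Type u) [TopologicalSpace X] : Prop :=
  ¬ ∃ Y : Set X, Dense Y ∧ Entangled Y

/-- Tame ideals: no `ω`-hitting ideal on `ℕ` (containing the finite sets) is pulled back into the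
ideal by a map from a positive set. -/
def Tame {X : Type u} (𝓘 : Order.Ideal (Set X)) : Prop :=
  ∀ Y : Set X, Y ∉ 𝓘 → ∀ (f : Y → ℕ) (𝓙 : Order.Ideal (Set ℕ)),
    ContainsFinite 𝓙 → OmegaHitting (𝓙 : Set (Set ℕ)) →
      ∃ J ∈ 𝓙, (Subtype.val : Y → X) '' (f ⁻¹' J) ∉ 𝓘

/-- Ideals invariant under left and right translations and under inversion. -/
def InvariantIdeal {G : Type u} [Group G] (𝓘 : Order.Ideal (Set G)) : Prop :=
  ∀ I ∈ 𝓘, (∀ g : G, (fun h => g * h) '' I ∈ 𝓘 ∧ (fun h => h * g) '' I ∈ 𝓘) ∧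
    (fun h => h⁻¹) '' I ∈ 𝓘

/-- Weakly closed ideals: for every sequence `C` converging to `1`, adding to a set `A` all the
points `x` for which `C · x` is almost contained in `A` does not change membership of `A`. -/
def WeaklyClosed {G : Type u} [Group G] [TopologicalSpace G] (𝓘 : Order.Ideal (Set G)) : Prop :=
  ∀ A C : Set G, SeqSetTendsto C 1 →
    (A ∈ 𝓘 ↔ A ∪ {x | (((fun c => c * x) '' C) \ A).Finite} ∈ 𝓘)

/-- There is a countable sequence capturing subfamily of the ideal. -/
def HasSequenceCapturing {X : Type u} [TopologicalSpace X] (𝓘 : Order.Ideal (Set X)) : Prop :=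
  ∃ 𝒮 : Set (Set X), 𝒮.Countable ∧ (∀ I ∈ 𝒮, I ∈ 𝓘) ∧
    ∀ C : Set X, (∃ x, SeqSetTendsto C x) → ∃ I ∈ 𝒮, (C ∩ I).Infinite

/-- There is a countable almost `π`-network of positive sets for the ideal. -/
def HasAlmostPiNetwork {X : Type u} [TopologicalSpace X] (𝓘 : Order.Ideal (Set X)) : Prop :=
  ∃ 𝓗 : Set (Set X), 𝓗.Countable ∧ (∀ H ∈ 𝓗, H ∉ 𝓘) ∧
    ∀ U : Set X, IsOpen U → U.Nonempty → ∃ H ∈ 𝓗, H \ U ∈ 𝓘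

/-- The Invariant Ideal Axiom. (A `T₁` topological group is automatically Hausdorff and
completely regular.) -/
def InvariantIdealAxiom : Prop :=
  ∀ (G : Type u) [Group G] [TopologicalSpace G] [IsTopologicalGroup G] [T1Space G] [Countable G],
    Groomed G → ∀ 𝓘 : Order.Ideal (Set G), ContainsFinite 𝓘 →
      Tame 𝓘 → WeaklyClosed 𝓘 → InvariantIdeal 𝓘 →
        HasSequenceCapturing 𝓘 ∨ HasAlmostPiNetwork 𝓘

open Filter
open scoped Pointwise

/-! A nondiscrete countable sequential group is groomed, so the axiom offers a "capturing" or a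
"network" alternative for each suitable ideal. It is used three times. For nowhere dense sets, a
network gives a countable π-base, hence metrizability; otherwise closed nowhere dense sets `N k`
almost contain all convergent sequences. For sets whose closure is almost disjoint from all infinite
closed discrete sets, capturing gives countably many compact sets determining the topology;
otherwise closed discrete sets `D n` form a π-network modulo finite sets.

It remains to exclude the last case. Call `y` escaping if it visits each `N k` finitely often, and
collect in `compensatedFamily` the ranges of those `d`, and of their inverses, for which `d l * y l`
converges for some escaping `y`. The third ideal consists of the sets with closure almost disjoint
from these ranges. Its network alternative would push escaping sequences into every neighbourhood of
1, while a diagonal union of them is closed (`not_network_compensatedFamily`). If instead sets `S k`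
capture, `false_of_network` refines the `D n` and forms closed discrete sets of products `b * y`,
with `y` ever further out, whose union is not closed. A convergent sequence in that union is almost
inside one `S k`; this forces infinitely many factors `b`, a compensated set, into `S k`.

Tameness of these ideals rests on `mem_closure_iUnion_dichotomy`, a consequence of sequentiality. -/

theorem finite_preimage_of_finite_fibers {α β : Type*} {f : α → β}
    (hf : ∀ y, {n | f n = y}.Finite) {s : Set β} (hs : s.Finite) : {n | f n ∈ s}.Finite := by
  refine (hs.biUnion fun y _ => hf y).subset fun n hn => ?_
  exact mem_biUnion (show f n ∈ s from hn) rfl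

theorem infinite_range_of_finite_fibers {α β : Type*} [Infinite α] {f : α → β}
    (hf : ∀ y, {n | f n = y}.Finite) : (range f).Infinite := fun h =>
  infinite_univ ((finite_preimage_of_finite_fibers hf h).subset fun n _ => mem_range_self n)

/-! ### Convergent sets and closures in sequential spaces -/

section Sequences

variable {X : Type u} [TopologicalSpace X]

/-- A set containing no infinite subset that converges, as a sequence, to a point of the space. -/
def NoConvergent (D : Set X) : Prop :=
  ∀ C ⊆ D, ∀ x, ¬ SeqSetTendsto C x

theorem NoConvergent.mono {D E : Set X} (hE : NoConvergent E) (h : D ⊆ E) : NoConvergent D :=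
  fun C hC => hE C (hC.trans h)

theorem SeqSetTendsto.mono {C D : Set X} {x : X} (hC : SeqSetTendsto C x) (hD : D ⊆ C)
    (hinf : D.Infinite) : SeqSetTendsto D x :=
  ⟨hinf, fun U hU => (hC.2 U hU).subset (sdiff_subset_sdiff_left hD)⟩

theorem SeqSetTendsto.image {C : Set X} {p : X} (hC : SeqSetTendsto C p) (e : X ≃ₜ X) :
    SeqSetTendsto (e '' C) (e p) := by
  refine ⟨hC.1.image e.injective.injOn, fun U hU => ?_⟩
  refine ((hC.2 _ (e.continuous.continuousAt.preimage_mem_nhds hU)).image e).subset ?_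
  rintro _ ⟨⟨c, hc, rfl⟩, hcU⟩
  exact ⟨c, ⟨hc, hcU⟩, rfl⟩

theorem NoConvergent.image {D : Set X} (hD : NoConvergent D) (e : X ≃ₜ X) :
    NoConvergent (e '' D) := by
  intro C hC p hp
  refine hD _ ?_ _ (hp.image e.symm)
  rintro _ ⟨c, hc, rfl⟩
  obtain ⟨d, hd, rfl⟩ := hC hc
  simpa using hd

theorem SeqSetTendsto.mem_of_isClosed {C F : Set X} {x : X} (hC : SeqSetTendsto C x)
    (hF : IsClosed F) (h : (C ∩ F).Infinite) : x ∈ F := by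
  by_contra hx
  refine h ((hC.2 Fᶜ (hF.isOpen_compl.mem_nhds hx)).subset ?_)
  rintro y ⟨hy, hyF⟩
  exact ⟨hy, fun h => h hyF⟩

theorem SeqSetTendsto.mem_closure {C A : Set X} {x : X} (hC : SeqSetTendsto C x)
    (h : (C ∩ A).Infinite) : x ∈ closure A :=
  hC.mem_of_isClosed isClosed_closure
    (h.mono (inter_subset_inter_right _ subset_closure))

theorem seqSetTendsto_range {y : ℕ → X} {p : X} (hy : Tendsto y atTop (𝓝 p))
    (hinf : (range y).Infinite) : SeqSetTendsto (range y) p := by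
  refine ⟨hinf, fun U hU => ?_⟩
  have h : {n | y n ∉ U}.Finite := by
    have := hy.eventually hU
    rw [← Nat.cofinite_eq_atTop] at this
    exact this
  refine (h.image y).subset ?_
  rintro _ ⟨⟨n, rfl⟩, hn⟩
  exact ⟨n, hn, rfl⟩

/-- In a sequential `T₁` space, a set that is not closed contains an infinite subset converging
to a point outside of it. -/
theorem exists_seqSetTendsto_of_not_isClosed [T1Space X] [SequentialSpace X] {E : Set X}
    (hE : ¬ IsClosed E) : ∃ C ⊆ E, ∃ p ∉ E, SeqSetTendsto C p := by
  by_contra hcon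
  push Not at hcon
  refine hE (IsSeqClosed.isClosed fun y p hy hp => ?_)
  by_contra hpE
  have hsub : range y ⊆ E := range_subset_iff.2 hy
  refine hcon _ hsub p hpE (seqSetTendsto_range hp fun hfin => hpE ?_)
  exact hsub (hfin.isClosed.mem_of_tendsto hp (Eventually.of_forall mem_range_self))

theorem NoConvergent.isClosed [T1Space X] [SequentialSpace X] {E : Set X} (hE : NoConvergent E) :
    IsClosed E := by
  by_contra h
  obtain ⟨C, hC, p, -, hCp⟩ := exists_seqSetTendsto_of_not_isClosed h
  exact hE C hC p hCp

theorem NoConvergent.exists_nhds_inter_finite [T1Space X] [SequentialSpace X] {E : Set X}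
    (hE : NoConvergent E) (z : X) : ∃ O ∈ 𝓝 z, (E ∩ O).Finite := by
  have h : IsClosed (E \ {z}) := (hE.mono sdiff_subset).isClosed
  refine ⟨(E \ {z})ᶜ, h.isOpen_compl.mem_nhds (by simp), (finite_singleton z).subset ?_⟩
  rintro y ⟨hy, hy'⟩
  by_contra hne
  exact hy' ⟨hy, hne⟩

theorem noConvergent_of_nhds_inter_finite {E : Set X}
    (h : ∀ z, ∃ O ∈ 𝓝 z, (E ∩ O).Finite) : NoConvergent E := by
  intro C hC p hp
  obtain ⟨O, hO, hfin⟩ := h p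
  refine hp.1 (((hp.2 O hO).union hfin).subset fun x hx => ?_)
  by_cases hxO : x ∈ O
  · exact Or.inr ⟨hC hx, hxO⟩
  · exact Or.inl ⟨hx, hxO⟩

/-- A family of sets captures the convergent sequences if each of them has an infinite
intersection with some member; for an increasing family some member contains almost all of it. -/
theorem exists_diff_finite_of_monotone {S : ℕ → Set X} (hS : Monotone S)
    (hcap : ∀ C : Set X, (∃ x, SeqSetTendsto C x) → ∃ k, (C ∩ S k).Infinite)
    {C : Set X} {x : X} (hC : SeqSetTendsto C x) : ∃ k, (C \ S k).Finite := by
  by_contra! hcon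
  have hchoose : ∀ (k : ℕ) (F : Finset X), ∃ c ∈ C \ S k, c ∉ F := fun k F => by
    obtain ⟨c, hc, hcF⟩ := (hcon k).exists_notMem_finset F
    exact ⟨c, hc, hcF⟩
  -- Diagonal choice: distinct points of `C` with `c k ∉ S k` still converge, but no `S k` can
  -- contain infinitely many of them.
  have hinf : ∃ c : ℕ → X, Function.Injective c ∧ ∀ k, c k ∈ C \ S k := by
    choose g hg hgF using hchoose
    classical
    let F : ℕ → Finset X := fun n => Nat.rec ∅ (fun k F => insert (g k F) F) n
    have hF : ∀ n, F (n + 1) = insert (g n (F n)) (F n) := fun n => rfl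
    have hmono : Monotone F := monotone_nat_of_le_succ fun n => by
      rw [hF]; exact Finset.subset_insert _ _
    have hlt : ∀ m n, m < n → g m (F m) ≠ g n (F n) := by
      intro m n hmn heq
      apply hgF n (F n)
      have : g m (F m) ∈ F (m + 1) := by rw [hF]; exact Finset.mem_insert_self _ _
      rw [← heq]
      exact hmono hmn this
    refine ⟨fun n => g n (F n), fun m n heq => ?_, fun k => hg k _⟩
    rcases lt_trichotomy m n with h | h | h
    · exact (hlt m n h heq).elim
    · exact h
    · exact (hlt n m h heq.symm).elim
  obtain ⟨c, hcinj, hc⟩ := hinf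
  have hsub : range c ⊆ C := by rintro _ ⟨n, rfl⟩; exact (hc n).1
  obtain ⟨k, hk⟩ := hcap (range c) ⟨x, hC.mono hsub (infinite_range_of_injective hcinj)⟩
  refine hk (((finite_lt_nat k).image c).subset ?_)
  rintro _ ⟨⟨n, rfl⟩, hn⟩
  refine ⟨n, ?_, rfl⟩
  by_contra hkn
  exact (hc n).2 (hS (not_lt.1 hkn) hn)

/-- A point in the closure of a union of countably many sets is either in the closure of one of
them, or in the closure of the union over every index set hitting suitable countably many infinite
sets. -/
theorem mem_closure_iUnion_dichotomy [SequentialSpace X] (A : ℕ → Set X) {x : X}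
    (hx : x ∈ closure (⋃ n, A n)) :
    (∃ n, x ∈ closure (A n)) ∨ ∃ 𝒴 : Set (Set ℕ), 𝒴.Countable ∧ (∀ Y ∈ 𝒴, Y.Infinite) ∧
      ∀ J : Set ℕ, (∀ Y ∈ 𝒴, (Y ∩ J).Infinite) → x ∈ closure (⋃ j ∈ J, A j) := by
  let Q : X → Prop := fun x => ∃ 𝒴 : Set (Set ℕ), 𝒴.Countable ∧ (∀ Y ∈ 𝒴, Y.Infinite) ∧
      ∀ J : Set ℕ, (∀ Y ∈ 𝒴, (Y ∩ J).Infinite) → x ∈ closure (⋃ j ∈ J, A j)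
  let Z : Set X := {x | (∃ n, x ∈ closure (A n)) ∨ Q x}
  have hZ : IsClosed Z := by
    refine IsSeqClosed.isClosed fun y p hy hp => ?_
    -- Infinitely many terms of the second kind: pool their witnesses. Otherwise almost all `y i`
    -- lie in single closures, and either finitely many indices suffice or the set of indices used
    -- is itself the witness.
    by_cases hQ : {i | Q (y i)}.Infinite
    · right
      choose! 𝒴 h𝒴 using fun i (hi : i ∈ {i | Q (y i)}) => hi
      refine ⟨⋃ i ∈ {i | Q (y i)}, 𝒴 i, ?_, ?_, ?_⟩
      · exact (to_countable _).biUnion fun i hi => (h𝒴 i hi).1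
      · intro Y hY
        simp only [mem_iUnion] at hY
        obtain ⟨i, hi, hY⟩ := hY
        exact (h𝒴 i hi).2.1 Y hY
      · intro J hJ
        refine isClosed_closure.mem_of_frequently_of_tendsto ?_ hp
        refine (Nat.frequently_atTop_iff_infinite.2 hQ).mono fun i hi => ?_
        exact (h𝒴 i hi).2.2 J fun Y hY => hJ Y (mem_biUnion hi hY)
    · have hQ' : ∀ᶠ i in atTop, ¬ Q (y i) := by
        by_contra h
        exact hQ (Nat.frequently_atTop_iff_infinite.1 h)
      obtain ⟨i₀, hi₀⟩ := eventually_atTop.1 hQ'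
      have hex : ∀ i, ∃ n, y (i + i₀) ∈ closure (A n) := fun i =>
        (hy (i + i₀)).resolve_right (hi₀ _ (Nat.le_add_left _ _))
      choose n hn using hex
      have hp' : Tendsto (fun i => y (i + i₀)) atTop (𝓝 p) := hp.comp (tendsto_add_atTop_nat i₀)
      by_cases hfin : (range n).Finite
      · left
        by_contra! hcon
        have hU : ∀ᶠ i in atTop, y (i + i₀) ∉ ⋃ m ∈ range n, closure (A m) := by
          have hcl : IsClosed (⋃ m ∈ range n, closure (A m)) :=
            hfin.isClosed_biUnion fun _ _ => isClosed_closure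
          refine hp'.eventually (hcl.isOpen_compl.mem_nhds ?_)
          simp only [mem_compl_iff, mem_iUnion, not_exists]
          exact fun m _ => hcon m
        obtain ⟨i, hi⟩ := hU.exists
        exact hi (mem_biUnion (mem_range_self i) (hn i))
      · right
        refine ⟨{range n}, countable_singleton _, by simpa using hfin, fun J hJ => ?_⟩
        have hJ' := hJ (range n) rfl
        refine isClosed_closure.mem_of_frequently_of_tendsto ?_ hp'
        refine Nat.frequently_atTop_iff_infinite.2 fun hf => hJ' ?_
        refine (hf.image n).subset ?_
        rintro _ ⟨⟨i, rfl⟩, hi⟩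
        exact ⟨i, closure_mono (subset_biUnion_of_mem (u := A) hi) (hn i), rfl⟩
  have hsub : ⋃ n, A n ⊆ Z := iUnion_subset fun n x hx => Or.inl ⟨n, subset_closure hx⟩
  exact closure_minimal hsub hZ hx

end Sequences

/-! ### Ideals to which the axiom applies -/

section Ideals

variable {G : Type u} [Group G] [TopologicalSpace G]

/-- The properties of a family of subsets of a topological group which make it an ideal to which
the Invariant Ideal Axiom applies; tameness is stated for countable unions. -/
structure IsTameClosedInvariant (P : Set G → Prop) : Prop where
  mono : ∀ A B, A ⊆ B → P B → P A
  union : ∀ A B, P A → P B → P (A ∪ B)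
  finite : ∀ A, A.Finite → P A
  closure_mem : ∀ A, P A → P (closure A)
  mul_left : ∀ A g, P A → P ((fun h => g * h) '' A)
  mul_right : ∀ A g, P A → P ((fun h => h * g) '' A)
  inv : ∀ A, P A → P ((fun h => h⁻¹) '' A)
  tame : ∀ (A : ℕ → Set G) (𝓙 : Order.Ideal (Set ℕ)), ContainsFinite 𝓙 →
    OmegaHitting (𝓙 : Set (Set ℕ)) → (∀ J ∈ 𝓙, P (⋃ j ∈ J, A j)) → P (⋃ n, A n)

/-- The ideal of all sets satisfying an `IsTameClosedInvariant` predicate. -/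
def IsTameClosedInvariant.ideal {P : Set G → Prop} (hP : IsTameClosedInvariant P) :
    Order.Ideal (Set G) :=
  Order.IsIdeal.toIdeal (I := {A | P A})
    { IsLowerSet := fun A B hBA hA => hP.mono B A hBA hA
      Nonempty := ⟨∅, hP.finite _ finite_empty⟩
      Directed := fun A hA B hB =>
        ⟨A ∪ B, hP.union A B hA hB, subset_union_left, subset_union_right⟩ }

theorem IsTameClosedInvariant.mem_ideal {P : Set G → Prop} (hP : IsTameClosedInvariant P)
    {A : Set G} : A ∈ hP.ideal ↔ P A := Iff.rfl

theorem SeqSetTendsto.mul_right [IsTopologicalGroup G] {C : Set G} {p : G}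
    (hC : SeqSetTendsto C p) (x : G) : SeqSetTendsto ((fun c => c * x) '' C) (p * x) :=
  hC.image (Homeomorph.mulRight x)

/-- A sequential space that is not discrete contains a nontrivial convergent sequence in every
dense subset, so that no dense subset is entangled. -/
theorem groomed_of_sequential {X : Type u} [TopologicalSpace X] [T1Space X] [SequentialSpace X]
    (hX : ¬ DiscreteTopology X) : Groomed X := by
  rintro ⟨Y, hdense, hent⟩
  have hexists : ∃ C ⊆ Y, ∃ p, SeqSetTendsto C p := by
    by_contra! hcon
    have hY : NoConvergent Y := hcon
    have huniv : Y = univ := by rw [← hY.isClosed.closure_eq]; exact hdense.closure_eq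
    refine hX (discreteTopology_iff_forall_isClosed.2 fun A => (hY.mono ?_).isClosed)
    rw [huniv]; exact subset_univ A
  obtain ⟨C, hCY, p, hC⟩ := hexists
  have himage : Subtype.val '' ((Subtype.val : Y → X) ⁻¹' C) = C := by
    rw [Subtype.image_preimage_coe]; exact inter_eq_right.2 hCY
  obtain ⟨B, hB, hB'⟩ := hent p {(Subtype.val : Y → X) ⁻¹' C} (countable_singleton _) (by
    rintro _ rfl hfin
    exact hC.1 (himage ▸ hfin.image Subtype.val))
  refine hB (hC.mem_closure ?_)
  have h := (hB' _ rfl).image (f := Subtype.val) Subtype.val_injective.injOn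
  refine h.mono ?_
  rintro _ ⟨y, ⟨hy, hyB⟩, rfl⟩
  exact ⟨hy, y, hyB, rfl⟩

theorem IsTameClosedInvariant.dichotomy [IsTopologicalGroup G] [T1Space G] [Countable G]
    [SequentialSpace G] (hIIA : InvariantIdealAxiom.{u}) (hG : ¬ DiscreteTopology G)
    {P : Set G → Prop} (hP : IsTameClosedInvariant P) :
    (∃ 𝒮 : Set (Set G), 𝒮.Countable ∧ (∀ I ∈ 𝒮, P I) ∧
      ∀ C : Set G, (∃ x, SeqSetTendsto C x) → ∃ I ∈ 𝒮, (C ∩ I).Infinite) ∨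
    ∃ 𝓗 : Set (Set G), 𝓗.Countable ∧ (∀ H ∈ 𝓗, ¬ P H) ∧
      ∀ U : Set G, IsOpen U → U.Nonempty → ∃ H ∈ 𝓗, P (H \ U) := by
  refine hIIA G (groomed_of_sequential hG) hP.ideal (fun F hF => hP.finite F hF) ?_ ?_ ?_
  · intro Y hY f 𝓙 hfin hhit
    by_contra! hcon
    refine hY ?_
    have h := hP.tame (fun n => Subtype.val '' (f ⁻¹' {n})) 𝓙 hfin hhit fun J hJ => by
      refine hP.mono _ _ ?_ (hP.mem_ideal.1 (hcon J hJ))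
      refine iUnion₂_subset fun j hj => image_mono (preimage_mono ?_)
      exact singleton_subset_iff.2 hj
    refine hP.mono _ _ (fun y hy => ?_) h
    exact mem_iUnion.2 ⟨f ⟨y, hy⟩, ⟨y, hy⟩, rfl, rfl⟩
  · intro A C hC
    refine ⟨fun hA => ?_, fun h => hP.mono _ _ subset_union_left h⟩
    -- Since `C * x` converges to `x`, the points added to `A` lie in its closure.
    refine hP.mono _ _ (union_subset subset_closure fun x hx => ?_) (hP.closure_mem A hA)
    have hCx := hC.mul_right x
    rw [one_mul] at hCx
    refine hCx.mem_closure ?_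
    have := hCx.1.sdiff hx
    rwa [sdiff_sdiff_right_self] at this
  · exact fun I hI => ⟨fun g => ⟨hP.mul_left I g hI, hP.mul_right I g hI⟩, hP.inv I hI⟩

end Ideals


/-! ### The nowhere dense ideal and metrizability -/

section NowhereDense

theorem IsNowhereDense.union {X : Type u} [TopologicalSpace X] {s t : Set X}
    (hs : IsNowhereDense s) (ht : IsNowhereDense t) : IsNowhereDense (s ∪ t) := by
  rw [IsNowhereDense, closure_union,
    interior_union_isClosed_of_interior_empty isClosed_closure ht]
  exact hs

variable {G : Type u} [Group G] [TopologicalSpace G] [IsTopologicalGroup G]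

theorem isNowhereDense_of_finite [T1Space G] (hG : ¬ DiscreteTopology G) {A : Set G}
    (hA : A.Finite) : IsNowhereDense A := by
  induction A, hA using Set.Finite.induction_on with
  | empty => exact isNowhereDense_empty
  | @insert a s _ _ ih =>
    rw [insert_eq]
    refine IsNowhereDense.union ?_ ih
    rw [isClosed_singleton.isNowhereDense_iff]
    by_contra h
    have hne : (interior ({a} : Set G)).Nonempty := nonempty_iff_ne_empty.2 h
    have ha : interior ({a} : Set G) = {a} := by
      refine subset_antisymm interior_subset (singleton_subset_iff.2 ?_)
      obtain ⟨b, hb⟩ := hne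
      have hba : b = a := mem_singleton_iff.1 (interior_subset hb)
      rwa [hba] at hb
    have hopen : IsOpen ({a} : Set G) := interior_eq_iff_isOpen.1 ha
    refine hG (discreteTopology_of_isOpen_singleton_one ?_)
    have := hopen.preimage (continuous_const_mul a)
    convert this using 1
    ext x
    simp

/-- If the union were dense in an open `U`, each point of `U` would have countably many infinite
index sets such that any `J` hitting them keeps the point in the closure. As `U` is countable, one
`J` in the ideal serves all its points. -/
theorem iUnion_isNowhereDense_of_omegaHitting {X : Type u} [TopologicalSpace X]
    [SequentialSpace X] [Countable X] (A : ℕ → Set X) (𝓙 : Order.Ideal (Set ℕ))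
    (hfin : ContainsFinite 𝓙) (hhit : OmegaHitting (𝓙 : Set (Set ℕ)))
    (h : ∀ J ∈ 𝓙, IsNowhereDense (⋃ j ∈ J, A j)) : IsNowhereDense (⋃ n, A n) := by
  by_contra hne
  set U := interior (closure (⋃ n, A n)) with hU
  have hUne : U.Nonempty := nonempty_iff_ne_empty.2 hne
  -- Removing finitely many `A j` removes only a nowhere dense set.
  have htail : ∀ n, U ⊆ closure (⋃ m, {x | n < m ∧ x ∈ A m}) := by
    intro n
    have hle : IsNowhereDense (⋃ j ∈ {j | j ≤ n}, A j) := h _ (hfin _ (finite_le_nat n))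
    have hcover : U ⊆ closure (⋃ j ∈ {j | j ≤ n}, A j) ∪
        closure (⋃ m, {x | n < m ∧ x ∈ A m}) := by
      rw [← closure_union]
      refine interior_subset.trans (closure_mono (iUnion_subset fun m x hx => ?_))
      rcases le_or_gt m n with hm | hm
      · exact Or.inl (mem_biUnion (show m ∈ {j | j ≤ n} from hm) hx)
      · exact Or.inr (mem_iUnion.2 ⟨m, hm, hx⟩)
    by_contra hcon
    obtain ⟨x, hxU, hx⟩ := not_subset.1 hcon
    have hopen : IsOpen (U \ closure (⋃ m, {x | n < m ∧ x ∈ A m})) :=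
      isOpen_interior.sdiff isClosed_closure
    have hsub : U \ closure (⋃ m, {x | n < m ∧ x ∈ A m}) ⊆
        interior (closure (⋃ j ∈ {j | j ≤ n}, A j)) :=
      interior_maximal (fun y hy => (hcover hy.1).resolve_right hy.2) hopen
    rw [hle] at hsub
    exact hsub ⟨hxU, hx⟩
  have hgood : ∀ x ∈ U, ∃ 𝒴 : Set (Set ℕ), 𝒴.Countable ∧ (∀ Y ∈ 𝒴, Y.Infinite) ∧
      ∀ J : Set ℕ, (∀ Y ∈ 𝒴, (Y ∩ J).Infinite) → x ∈ closure (⋃ j ∈ J, A j) := by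
    intro x hx
    by_cases hinf : {m | x ∈ closure (A m)}.Infinite
    · refine ⟨{{m | x ∈ closure (A m)}}, countable_singleton _, by simpa using hinf, ?_⟩
      intro J hJ
      obtain ⟨m, hm, hmJ⟩ := (hJ _ rfl).nonempty
      exact closure_mono (subset_biUnion_of_mem (u := A) hmJ) hm
    · obtain ⟨n, hn⟩ := (not_infinite.1 hinf).bddAbove
      rcases mem_closure_iUnion_dichotomy _ (htail n hx) with ⟨m, hm⟩ | ⟨𝒴, hc, hi, hJ⟩
      · exfalso
        by_cases hnm : n < m
        · have : m ∈ {m | x ∈ closure (A m)} := closure_mono (fun y hy => hy.2) hm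
          exact absurd (hn this) (not_le.2 hnm)
        · simp [hnm] at hm
      · refine ⟨𝒴, hc, hi, fun J hJ' => closure_mono ?_ (hJ J hJ')⟩
        exact iUnion₂_mono fun j _ y hy => hy.2
  choose! 𝒴 h𝒴 using hgood
  obtain ⟨J, hJ, hJ'⟩ := hhit (⋃ x ∈ U, 𝒴 x)
    ((to_countable U).biUnion fun x hx => (h𝒴 x hx).1) (by
      intro Y hY
      simp only [mem_iUnion] at hY
      obtain ⟨x, hx, hY⟩ := hY
      exact (h𝒴 x hx).2.1 Y hY)
  have hsub : U ⊆ closure (⋃ j ∈ J, A j) := fun x hx =>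
    (h𝒴 x hx).2.2 J fun Y hY => hJ' Y (mem_biUnion hx hY)
  have := interior_maximal hsub isOpen_interior
  rw [h J hJ] at this
  exact hUne.ne_empty (subset_empty_iff.1 this)

theorem isTameClosedInvariant_isNowhereDense [T1Space G] [Countable G] [SequentialSpace G]
    (hG : ¬ DiscreteTopology G) : IsTameClosedInvariant (IsNowhereDense : Set G → Prop) where
  mono _ _ h hB := hB.mono h
  union _ _ hA hB := hA.union hB
  finite _ hA := isNowhereDense_of_finite hG hA
  closure_mem _ hA := hA.closure
  mul_left _ g hA := (Homeomorph.mulLeft g).isInducing.isNowhereDense_image hA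
  mul_right _ g hA := (Homeomorph.mulRight g).isInducing.isNowhereDense_image hA
  inv _ hA := (Homeomorph.inv G).isInducing.isNowhereDense_image hA
  tame := iUnion_isNowhereDense_of_omegaHitting

theorem exists_isOpen_closure_subset {X : Type u} [TopologicalSpace X] [RegularSpace X]
    {U : Set X} (hU : IsOpen U) (hne : U.Nonempty) :
    ∃ V, IsOpen V ∧ V.Nonempty ∧ closure V ⊆ U := by
  obtain ⟨x, hx⟩ := hne
  obtain ⟨K, hK, hKc, hKU⟩ := exists_mem_nhds_isClosed_subset (hU.mem_nhds hx)
  exact ⟨interior K, isOpen_interior, ⟨x, mem_interior_iff_mem_nhds.2 hK⟩,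
    (closure_minimal interior_subset hKc).trans hKU⟩

theorem metrizableSpace_of_countable_piBase [T1Space G] (𝓑 : Set (Set G)) (hc : 𝓑.Countable)
    (hopen : ∀ B ∈ 𝓑, IsOpen B) (hne : ∀ B ∈ 𝓑, B.Nonempty)
    (hpi : ∀ U : Set G, IsOpen U → U.Nonempty → ∃ B ∈ 𝓑, B ⊆ U) :
    TopologicalSpace.MetrizableSpace G := by
  -- Quotients `B / B` turn a π-base into a neighbourhood base at 1.
  have hbasis : (𝓝 (1 : G)).HasBasis (fun B => B ∈ 𝓑) (fun B => B / B) := by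
    refine ⟨fun s => ⟨fun hs => ?_, ?_⟩⟩
    · obtain ⟨V, hV, hVs⟩ := exists_nhds_split_inv hs
      obtain ⟨B, hB, hBV⟩ := hpi (interior V) isOpen_interior ⟨1, mem_interior_iff_mem_nhds.2 hV⟩
      refine ⟨B, hB, ?_⟩
      rintro _ ⟨a, ha, b, hb, rfl⟩
      exact hVs a (interior_subset (hBV ha)) b (interior_subset (hBV hb))
    · rintro ⟨B, hB, hBs⟩
      refine mem_of_superset ((hopen B hB).div_right.mem_nhds ?_) hBs
      obtain ⟨b, hb⟩ := hne B hB
      exact ⟨b, hb, b, hb, div_self' b⟩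
  have hgen : (𝓝 (1 : G)).IsCountablyGenerated := HasCountableBasis.isCountablyGenerated ⟨hbasis, hc⟩
  let _ := IsTopologicalGroup.rightUniformSpace G
  have : (uniformity G).IsCountablyGenerated := by
    rw [uniformity_eq_comap_nhds_one']
    infer_instance
  exact UniformSpace.metrizableSpace

theorem metrizableSpace_or_exists_capturing_isNowhereDense [T1Space G] [Countable G]
    [SequentialSpace G] (hIIA : InvariantIdealAxiom.{u}) (hG : ¬ DiscreteTopology G) :
    TopologicalSpace.MetrizableSpace G ∨
    ∃ 𝒮 : Set (Set G), 𝒮.Countable ∧ (∀ I ∈ 𝒮, IsNowhereDense I) ∧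
      ∀ C : Set G, (∃ x, SeqSetTendsto C x) → ∃ I ∈ 𝒮, (C ∩ I).Infinite := by
  rcases (isTameClosedInvariant_isNowhereDense hG).dichotomy hIIA hG with h | ⟨𝓗, hc, hH, hpi⟩
  · exact Or.inr h
  · left
    refine metrizableSpace_of_countable_piBase ((fun H => interior (closure H)) '' 𝓗)
      (hc.image _) ?_ ?_ ?_
    · rintro _ ⟨H, -, rfl⟩
      exact isOpen_interior
    · rintro _ ⟨H, hH', rfl⟩
      exact nonempty_iff_ne_empty.2 (hH H hH')
    · intro U hU hne
      obtain ⟨V, hV, hVne, hVU⟩ := exists_isOpen_closure_subset hU hne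
      obtain ⟨H, hH', hHV⟩ := hpi V hV hVne
      refine ⟨_, mem_image_of_mem _ hH', ?_⟩
      intro x hx
      by_contra hxU
      have hcover : closure H ⊆ closure (H \ V) ∪ closure V := by
        rw [← closure_union]
        refine closure_mono fun y hy => ?_
        by_cases hyV : y ∈ V
        · exact Or.inr hyV
        · exact Or.inl ⟨hy, hyV⟩
      have hsub : interior (closure H) \ closure V ⊆ interior (closure (H \ V)) :=
        interior_maximal (fun y hy => (hcover (interior_subset hy.1)).resolve_right hy.2)
          (isOpen_interior.sdiff isClosed_closure)
      rw [hHV] at hsub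
      exact hsub ⟨hx, fun h => hxU (hVU h)⟩

end NowhereDense

/-! ### Sets with closure almost disjoint from an invariant family -/

section AlmostDisjoint

theorem closure_image_inter_finite {X : Type u} [TopologicalSpace X] {A D : Set X} (e : X ≃ₜ X)
    (h : (closure A ∩ e.symm '' D).Finite) : (closure (e '' A) ∩ D).Finite := by
  rw [← e.image_closure]
  refine (h.image e).subset ?_
  rintro _ ⟨⟨x, hx, rfl⟩, hxD⟩
  exact ⟨x, ⟨hx, e x, hxD, e.symm_apply_apply x⟩, rfl⟩

variable {G : Type u} [Group G] [TopologicalSpace G]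

/-- A family of subsets of a group invariant under translations and inversion. -/
structure IsInvariantFamily (𝒟 : Set (Set G)) : Prop where
  mul_left : ∀ D ∈ 𝒟, ∀ g : G, (fun h => g * h) '' D ∈ 𝒟
  mul_right : ∀ D ∈ 𝒟, ∀ g : G, (fun h => h * g) '' D ∈ 𝒟
  inv : ∀ D ∈ 𝒟, (fun h => h⁻¹) '' D ∈ 𝒟

theorem isTameClosedInvariant_almostDisjoint [IsTopologicalGroup G] [T1Space G] [Countable G] [SequentialSpace G]
    {𝒟 : Set (Set G)} (h𝒟 : IsInvariantFamily 𝒟) :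
    IsTameClosedInvariant (fun A : Set G => ∀ D ∈ 𝒟, (closure A ∩ D).Finite) where
  mono _ _ h hB D hD := (hB D hD).subset (inter_subset_inter_left _ (closure_mono h))
  union A B hA hB D hD := by
    rw [closure_union, union_inter_distrib_right]
    exact (hA D hD).union (hB D hD)
  finite A hA D _ := by
    rw [hA.isClosed.closure_eq]
    exact hA.inter_of_left D
  closure_mem A hA D hD := by
    rw [closure_closure]
    exact hA D hD
  mul_left A g hA D hD :=
    closure_image_inter_finite (Homeomorph.mulLeft g) (hA _ (h𝒟.mul_left D hD g⁻¹))
  mul_right A g hA D hD :=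
    closure_image_inter_finite (Homeomorph.mulRight g) (hA _ (h𝒟.mul_right D hD g⁻¹))
  inv A hA D hD :=
    closure_image_inter_finite (Homeomorph.inv G) (hA _ (h𝒟.inv D hD))
  tame A 𝓙 hfin hhit h D hD := by
    by_contra hinf
    have hone : ∀ n, (closure (A n) ∩ D).Finite := fun n => by
      have := h {n} (hfin _ (finite_singleton n)) D hD
      simpa using this
    set E : Set G := closure (⋃ n, A n) ∩ D with hE
    -- If infinitely many points lie in single closures, their indices form an infinite set to be
    -- hit; otherwise the remaining points of `E` all have hitting witnesses.
    by_cases hex : {x ∈ E | ∃ n, x ∈ closure (A n)}.Infinite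
    · choose! n hn using fun x (hx : x ∈ {x ∈ E | ∃ n, x ∈ closure (A n)}) => hx.2
      have hM : (n '' {x ∈ E | ∃ n, x ∈ closure (A n)}).Infinite := by
        intro hM
        refine hex ((hM.biUnion fun m _ => hone m).subset fun x hx => ?_)
        exact mem_biUnion (mem_image_of_mem n hx) ⟨hn x hx, hx.1.2⟩
      obtain ⟨J, hJ, hJ'⟩ := hhit _ (countable_singleton _) (fun Y hY => by
        rw [mem_singleton_iff.1 hY]; exact hM)
      refine hJ' _ rfl (((h J hJ D hD).image n).subset ?_)
      rintro _ ⟨⟨x, hx, rfl⟩, hxJ⟩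
      exact ⟨x, ⟨closure_mono (subset_biUnion_of_mem (u := A) hxJ) (hn x hx), hx.1.2⟩, rfl⟩
    · have hrest : (E \ {x ∈ E | ∃ n, x ∈ closure (A n)}).Infinite :=
        Set.Infinite.sdiff hinf (not_infinite.1 hex)
      have hgood : ∀ x ∈ E \ {x ∈ E | ∃ n, x ∈ closure (A n)},
          ∃ 𝒴 : Set (Set ℕ), 𝒴.Countable ∧ (∀ Y ∈ 𝒴, Y.Infinite) ∧
          ∀ J : Set ℕ, (∀ Y ∈ 𝒴, (Y ∩ J).Infinite) → x ∈ closure (⋃ j ∈ J, A j) :=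
        fun x hx => (mem_closure_iUnion_dichotomy A hx.1.1).resolve_left
          fun hn => hx.2 ⟨hx.1, hn⟩
      choose! 𝒴 h𝒴 using hgood
      obtain ⟨J, hJ, hJ'⟩ := hhit (⋃ x ∈ E \ {x ∈ E | ∃ n, x ∈ closure (A n)}, 𝒴 x)
        ((to_countable _).biUnion fun x hx => (h𝒴 x hx).1) (by
          intro Y hY
          simp only [mem_iUnion] at hY
          obtain ⟨x, hx, hY⟩ := hY
          exact (h𝒴 x hx).2.1 Y hY)
      refine hrest ((h J hJ D hD).subset fun x hx => ⟨?_, hx.1.2⟩)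
      exact (h𝒴 x hx).2.2 J fun Y hY => hJ' Y (mem_biUnion hx hY)

/-- A countable capturing subfamily of an ideal closed under closures may be taken to be an
increasing sequence of closed sets. -/
theorem IsTameClosedInvariant.exists_monotone {P : Set G → Prop} (hP : IsTameClosedInvariant P)
    {𝒮 : Set (Set G)} (hne : 𝒮.Nonempty) (hc : 𝒮.Countable) (hS : ∀ I ∈ 𝒮, P I)
    (hcap : ∀ C : Set G, (∃ x, SeqSetTendsto C x) → ∃ I ∈ 𝒮, (C ∩ I).Infinite) :
    ∃ S : ℕ → Set G, Monotone S ∧ (∀ k, IsClosed (S k)) ∧ (∀ k, P (S k)) ∧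
      (∀ C x, SeqSetTendsto C x → ∃ k, (C \ S k).Finite) ∧ (∀ I ∈ 𝒮, ∃ k, I ⊆ S k) ∧
      ∀ e : G ≃ₜ G, (∀ I ∈ 𝒮, e '' I ∈ 𝒮) → ∀ k, ∃ m, e '' S k ⊆ S m := by
  obtain ⟨I, rfl⟩ := hc.exists_eq_range hne
  have hmono : Monotone fun k => closure (accumulate I k) :=
    fun a b hab => closure_mono (monotone_accumulate hab)
  have hsub : ∀ k, I k ⊆ closure (accumulate I k) :=
    fun k => subset_accumulate.trans subset_closure
  refine ⟨fun k => closure (accumulate I k), hmono, fun k => isClosed_closure, fun k => ?_,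
    fun C x hC => ?_, ?_, fun e he k => ?_⟩
  · refine hP.closure_mem _ ?_
    induction k with
    | zero => simpa using hS _ (mem_range_self 0)
    | succ k ih =>
      rw [accumulate_succ]
      exact hP.union _ _ ih (hS _ (mem_range_self _))
  · refine exists_diff_finite_of_monotone hmono (fun C hC => ?_) hC
    obtain ⟨_, ⟨k, rfl⟩, hk⟩ := hcap C hC
    exact ⟨k, hk.mono (inter_subset_inter_right _ (hsub k))⟩
  · rintro _ ⟨k, rfl⟩
    exact ⟨k, hsub k⟩
  · suffices ∃ m, e '' accumulate I k ⊆ accumulate I m by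
      obtain ⟨m, hm⟩ := this
      refine ⟨m, ?_⟩
      simp only [e.image_closure]
      exact closure_mono hm
    have hex : ∀ i, ∃ j, I j = e '' I i := fun i => he _ (mem_range_self i)
    choose j hj using hex
    refine ⟨(Finset.range (k + 1)).sup j, ?_⟩
    rintro _ ⟨x, hx, rfl⟩
    obtain ⟨i, hi, hxi⟩ := mem_accumulate.1 hx
    refine mem_accumulate.2 ⟨j i, Finset.le_sup (Finset.mem_range.2 (Nat.lt_succ_of_le hi)), ?_⟩
    rw [hj]
    exact mem_image_of_mem e hxi

/-- Either countably many closed sets almost disjoint from all members of an invariant family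
capture all convergent sequences, or countably many infinite subsets of members of the family form
a `π`-network modulo finite sets. -/
theorem IsInvariantFamily.dichotomy [IsTopologicalGroup G] [T1Space G] [Countable G]
    [SequentialSpace G]
    (hIIA : InvariantIdealAxiom.{u}) (hG : ¬ DiscreteTopology G) {𝒟 : Set (Set G)}
    (h𝒟 : IsInvariantFamily 𝒟) :
    (∃ S : ℕ → Set G, Monotone S ∧ (∀ k, IsClosed (S k)) ∧ (∀ k, ∀ D ∈ 𝒟, (S k ∩ D).Finite) ∧
      ∀ C x, SeqSetTendsto C x → ∃ k, (C \ S k).Finite) ∨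
    ∃ B : ℕ → Set G, (∀ n, (B n).Infinite) ∧ (∀ n, ∃ D ∈ 𝒟, B n ⊆ D) ∧
      ∀ U : Set G, IsOpen U → U.Nonempty → ∃ n, (B n \ U).Finite := by
  have hP := isTameClosedInvariant_almostDisjoint h𝒟
  rcases hP.dichotomy hIIA hG with ⟨𝒮, hc, hS, hcap⟩ | ⟨𝓗, hc, hH, hpi⟩
  · left
    obtain ⟨S, hmono, hclosed, hPS, hcapS, -⟩ := hP.exists_monotone (𝒮 := insert ∅ 𝒮)
      (insert_nonempty _ _) (hc.insert _) (by
        rintro I (rfl | hI)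
        · exact hP.finite _ finite_empty
        · exact hS I hI) (fun C hC => by
        obtain ⟨I, hI, hCI⟩ := hcap C hC
        exact ⟨I, Or.inr hI, hCI⟩)
    refine ⟨S, hmono, hclosed, fun k D hD => ?_, hcapS⟩
    have := hPS k D hD
    rwa [(hclosed k).closure_eq] at this
  · right
    obtain ⟨H₀, hH₀, -⟩ := hpi univ isOpen_univ ⟨1, trivial⟩
    obtain ⟨H, rfl⟩ := hc.exists_eq_range ⟨H₀, hH₀⟩
    have hex : ∀ n, ∃ D ∈ 𝒟, (closure (H n) ∩ D).Infinite := fun n => by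
      have := hH _ (mem_range_self n)
      push Not at this
      exact this
    choose D hD hHD using hex
    refine ⟨fun n => closure (H n) ∩ D n, hHD, fun n => ⟨D n, hD n, inter_subset_right⟩, ?_⟩
    intro U hU hne
    obtain ⟨V, hV, hVne, hVU⟩ := exists_isOpen_closure_subset hU hne
    obtain ⟨_, ⟨n, rfl⟩, hn⟩ := hpi V hV hVne
    refine ⟨n, (hn (D n) (hD n)).subset ?_⟩
    rintro x ⟨⟨hx, hxD⟩, hxU⟩
    refine ⟨?_, hxD⟩
    have hcover : closure (H n) ⊆ closure (H n \ V) ∪ closure V := by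
      rw [← closure_union]
      refine closure_mono fun y hy => ?_
      by_cases hyV : y ∈ V
      · exact Or.inr hyV
      · exact Or.inl ⟨hy, hyV⟩
    exact (hcover hx).resolve_right fun h => hxU (hVU h)

end AlmostDisjoint

/-! ### Compactness and the `k_ω` property -/

section KOmega

variable {X : Type u} [TopologicalSpace X]

theorem isCompact_of_inter_noConvergent_finite [Countable X] {K : Set X} (hK : IsClosed K)
    (h : ∀ D : Set X, D.Infinite → NoConvergent D → (K ∩ D).Finite) : IsCompact K := by
  rcases K.eq_empty_or_nonempty with rfl | hne
  · exact isCompact_empty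
  obtain ⟨s, hs⟩ := (to_countable K).exists_eq_range hne
  refine isCompact_of_finite_subcover fun {ι} U hU hcover => ?_
  by_contra! hcon
  have hex : ∀ n, ∃ i, s n ∈ U i := fun n =>
    mem_iUnion.1 (hcover (hs ▸ mem_range_self n))
  choose i hi using hex
  -- Without a finite subcover, points avoiding longer and longer initial parts of the cover form an
  -- infinite locally finite subset of `K`.
  have hx : ∀ n, ∃ x ∈ K, ∀ m ≤ n, x ∉ U (i m) := by
    intro n
    classical
    obtain ⟨x, hxK, hx⟩ := not_subset.1 (hcon ((Finset.range (n + 1)).image i))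
    refine ⟨x, hxK, fun m hm hxm => hx (mem_biUnion ?_ hxm)⟩
    exact Finset.mem_coe.2 (Finset.mem_image_of_mem i (Finset.mem_range.2 (Nat.lt_succ_of_le hm)))
  choose x hxK hxU using hx
  have hfin : ∀ m, {n | x n ∈ U (i m)}.Finite := fun m =>
    (finite_lt_nat m).subset fun n hn => by
      by_contra hmn
      exact hxU n m (not_lt.1 hmn) hn
  have hinf : (range x).Infinite := by
    refine infinite_range_of_finite_fibers fun y => ?_
    by_cases hy : y ∈ K
    · rw [hs] at hy
      obtain ⟨m, rfl⟩ := hy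
      refine (hfin m).subset fun l hl => ?_
      have hl' : x l = s m := hl
      exact show x l ∈ U (i m) from hl' ▸ hi m
    · refine finite_empty.subset fun l hl => hy ?_
      have hl' : x l = y := hl
      exact hl' ▸ hxK l
  have hnc : NoConvergent (range x) := by
    refine noConvergent_of_nhds_inter_finite fun z => ?_
    by_cases hz : z ∈ K
    · rw [hs] at hz
      obtain ⟨m, rfl⟩ := hz
      refine ⟨U (i m), (hU _).mem_nhds (hi m), ((hfin m).image x).subset ?_⟩
      rintro _ ⟨⟨n, rfl⟩, hn⟩
      exact ⟨n, hn, rfl⟩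
    · refine ⟨Kᶜ, hK.isOpen_compl.mem_nhds hz, finite_empty.subset ?_⟩
      rintro _ ⟨⟨n, rfl⟩, hn⟩
      exact hn (hxK n)
  refine hinf ((h _ hinf hnc).subset ?_)
  rintro _ ⟨n, rfl⟩
  exact ⟨hxK n, n, rfl⟩

theorem isKOmega_of_capturing_compact [T1Space X] [SequentialSpace X] {S : ℕ → Set X}
    (hS : ∀ k, IsCompact (S k)) (hclosed : ∀ k, IsClosed (S k))
    (hcap : ∀ C x, SeqSetTendsto C x → ∃ k, (C \ S k).Finite) : IsKOmega X := by
  refine ⟨range S, countable_range S, ?_, fun U => ⟨fun hU K _ => hU.preimage continuous_subtype_val,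
    fun h => ?_⟩⟩
  · rintro _ ⟨k, rfl⟩
    exact hS k
  · rw [← isClosed_compl_iff]
    by_contra hcon
    obtain ⟨C, hC, p, hp, hCp⟩ := exists_seqSetTendsto_of_not_isClosed hcon
    rw [notMem_compl_iff] at hp
    obtain ⟨k, hk⟩ := hcap C p hCp
    have hinf : (C ∩ S k).Infinite := by
      have := hCp.1.sdiff hk
      rwa [sdiff_sdiff_right_self] at this
    have hpk : p ∈ S k := hCp.mem_of_isClosed (hclosed k) hinf
    obtain ⟨V, hV, hVU⟩ := isOpen_induced_iff.1 (h _ (mem_range_self k))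
    have hpV : p ∈ V := by
      have : (⟨p, hpk⟩ : S k) ∈ (Subtype.val : S k → X) ⁻¹' V := by rw [hVU]; exact hp
      exact this
    refine hinf ((hCp.2 V (hV.mem_nhds hpV)).subset ?_)
    rintro y ⟨hy, hyk⟩
    refine ⟨hy, fun hyV => hC hy ?_⟩
    have : (⟨y, hyk⟩ : S k) ∈ (Subtype.val : S k → X) ⁻¹' U := by rw [← hVU]; exact hyV
    exact this

end KOmega

/-! ### Escaping sequences and compensated terms -/

section Escaping

variable {G : Type u} [Group G] [TopologicalSpace G]

/-- An increasing sequence of closed nowhere dense sets, cofinally invariant under translations,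
that covers the group and almost contains every convergent sequence. -/
structure IsCapturingSequence (N : ℕ → Set G) : Prop where
  monotone : Monotone N
  isClosed : ∀ k, IsClosed (N k)
  isNowhereDense : ∀ k, IsNowhereDense (N k)
  cover : ∀ x, ∃ k, x ∈ N k
  mul_left : ∀ g k, ∃ m, (fun h => g * h) '' N k ⊆ N m
  mul_right : ∀ g k, ∃ m, (fun h => h * g) '' N k ⊆ N m
  capture : ∀ C x, SeqSetTendsto C x → ∃ k, (C \ N k).Finite

theorem exists_isCapturingSequence [IsTopologicalGroup G] [T1Space G] [Countable G]
    [SequentialSpace G] (hG : ¬ DiscreteTopology G) {𝒮 : Set (Set G)} (hc : 𝒮.Countable)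
    (hS : ∀ I ∈ 𝒮, IsNowhereDense I)
    (hcap : ∀ C : Set G, (∃ x, SeqSetTendsto C x) → ∃ I ∈ 𝒮, (C ∩ I).Infinite) :
    ∃ N : ℕ → Set G, IsCapturingSequence N := by
  have hP := isTameClosedInvariant_isNowhereDense hG
  -- All two-sided translates are adjoined for invariance; those of `{1}` make the sets cover the
  -- group.
  set 𝒯 : Set (Set G) :=
    (fun q : G × G × Set G => (fun x => q.1 * x * q.2.1) '' q.2.2) ''
      (univ ×ˢ univ ×ˢ insert {1} 𝒮) with h𝒯
  have hmem : ∀ g h, ∀ I ∈ insert {1} 𝒮, (fun x => g * x * h) '' I ∈ 𝒯 := fun g h I hI =>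
    ⟨(g, h, I), ⟨trivial, trivial, hI⟩, rfl⟩
  have hmem' : ∀ I ∈ insert {1} 𝒮, I ∈ 𝒯 := fun I hI => by
    have := hmem 1 1 I hI
    simpa using this
  obtain ⟨N, hmono, hclosed, hnwd, hcapN, hsub, htrans⟩ := hP.exists_monotone (𝒮 := 𝒯)
    ⟨_, hmem' {1} (mem_insert _ _)⟩
    ((countable_univ.prod (countable_univ.prod (hc.insert _))).image _) (by
      rintro _ ⟨⟨g, h, I⟩, ⟨-, -, hI⟩, rfl⟩
      have hI' : IsNowhereDense I := by
        rcases hI with rfl | hI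
        · exact hP.finite _ (finite_singleton 1)
        · exact hS I hI
      have := hP.mul_right _ h (hP.mul_left I g hI')
      rw [image_image] at this
      exact this) (fun C hC => by
      obtain ⟨I, hI, hCI⟩ := hcap C hC
      exact ⟨I, hmem' I (Or.inr hI), hCI⟩)
  refine ⟨N, hmono, hclosed, hnwd, fun x => ?_, fun g => ?_, fun g => ?_, hcapN⟩
  · obtain ⟨k, hk⟩ := hsub _ (hmem x 1 {1} (mem_insert _ _))
    exact ⟨k, hk ⟨1, rfl, by simp⟩⟩
  · refine htrans (Homeomorph.mulLeft g) ?_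
    rintro _ ⟨⟨a, b, I⟩, ⟨-, -, hI⟩, rfl⟩
    have := hmem (g * a) b I hI
    rw [image_image]
    simpa [mul_assoc] using this
  · refine htrans (Homeomorph.mulRight g) ?_
    rintro _ ⟨⟨a, b, I⟩, ⟨-, -, hI⟩, rfl⟩
    have := hmem a (b * g) I hI
    rw [image_image]
    simpa [mul_assoc] using this

/-- A sequence of points that visits each of the given sets only finitely often. -/
def Escapes {X : Type u} (N : ℕ → Set X) (y : ℕ → X) : Prop :=
  ∀ k, {l | y l ∈ N k}.Finite

theorem Escapes.comp {X : Type u} {N : ℕ → Set X} {y : ℕ → X} (hy : Escapes N y) {φ : ℕ → ℕ}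
    (hφ : Function.Injective φ) : Escapes N (y ∘ φ) :=
  fun k => Set.Finite.preimage (f := φ) (s := {l | y l ∈ N k}) hφ.injOn (hy k)

namespace IsCapturingSequence

variable {N : ℕ → Set G}

theorem escapes_mul_left (hN : IsCapturingSequence N) {y : ℕ → G} (hy : Escapes N y) (g : G) :
    Escapes N (fun l => g * y l) := by
  intro k
  obtain ⟨m, hm⟩ := hN.mul_left g⁻¹ k
  exact (hy m).subset fun l hl => hm ⟨g * y l, hl, by simp⟩

theorem escapes_mul_right (hN : IsCapturingSequence N) {y : ℕ → G} (hy : Escapes N y) (g : G) :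
    Escapes N (fun l => y l * g) := by
  intro k
  obtain ⟨m, hm⟩ := hN.mul_right g⁻¹ k
  exact (hy m).subset fun l hl => hm ⟨y l * g, hl, by simp⟩

theorem finite_fiber (hN : IsCapturingSequence N) {y : ℕ → G} (hy : Escapes N y) (x : G) :
    {l | y l = x}.Finite := by
  obtain ⟨k, hk⟩ := hN.cover x
  refine (hy k).subset fun l hl => ?_
  have hl' : y l = x := hl
  exact show y l ∈ N k from hl' ▸ hk

theorem not_tendsto (hN : IsCapturingSequence N) {y : ℕ → G} (hy : Escapes N y) (p : G) :
    ¬ Tendsto y atTop (𝓝 p) := by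
  intro h
  obtain ⟨k, hk⟩ := hN.capture _ _
    (seqSetTendsto_range h (infinite_range_of_finite_fibers (hN.finite_fiber hy)))
  have h₁ := finite_preimage_of_finite_fibers (hN.finite_fiber hy) hk
  refine infinite_univ (((hy k).union h₁).subset fun l _ => ?_)
  by_cases hl : y l ∈ N k
  · exact Or.inl hl
  · exact Or.inr ⟨mem_range_self l, hl⟩

/-- On a subsequence where `d` is constant, cancelling that constant would make an escaping sequence
converge. -/
theorem finite_fiber_of_tendsto_mul [IsTopologicalGroup G] (hN : IsCapturingSequence N)
    {d y : ℕ → G} {p : G} (hy : Escapes N y) (h : Tendsto (fun l => d l * y l) atTop (𝓝 p))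
    (x : G) : {l | d l = x}.Finite := by
  by_contra hinf
  obtain ⟨φ, hφ, hφx⟩ := extraction_of_frequently_atTop (Nat.frequently_atTop_iff_infinite.2 hinf)
  refine hN.not_tendsto (hy.comp hφ.injective) (x⁻¹ * p) ?_
  refine ((h.comp hφ.tendsto_atTop).const_mul x⁻¹).congr fun l => ?_
  simp [hφx l]

end IsCapturingSequence

/-- The sets of terms `d l`, and of their inverses, for which `d l * y l` converges for some
escaping sequence `y`. -/
def compensatedFamily (N : ℕ → Set G) : Set (Set G) :=
  {D | ∃ (d y : ℕ → G) (p : G), Escapes N y ∧ Tendsto (fun l => d l * y l) atTop (𝓝 p) ∧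
    (D = range d ∨ D = range fun l => (d l)⁻¹)}

namespace IsCapturingSequence

variable {N : ℕ → Set G} [IsTopologicalGroup G]

theorem isInvariantFamily (hN : IsCapturingSequence N) :
    IsInvariantFamily (compensatedFamily N) where
  mul_left := by
    rintro D ⟨d, y, p, hy, hp, rfl | rfl⟩ g
    · refine ⟨fun l => g * d l, y, g * p, hy, ?_, Or.inl ?_⟩
      · simpa [mul_assoc] using hp.const_mul g
      · rw [← range_comp]; rfl
    -- Inversion moves the translation between `d` and `y`, where it cancels in the product.
    · refine ⟨fun l => d l * g⁻¹, fun l => g * y l, p, hN.escapes_mul_left hy g, ?_, Or.inr ?_⟩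
      · simpa [mul_assoc] using hp
      · rw [← range_comp]; simp [Function.comp_def]
  mul_right := by
    rintro D ⟨d, y, p, hy, hp, rfl | rfl⟩ g
    · refine ⟨fun l => d l * g, fun l => g⁻¹ * y l, p, hN.escapes_mul_left hy g⁻¹, ?_, Or.inl ?_⟩
      · simpa [mul_assoc] using hp
      · rw [← range_comp]; rfl
    · refine ⟨fun l => g⁻¹ * d l, y, g⁻¹ * p, hy, ?_, Or.inr ?_⟩
      · simpa [mul_assoc] using hp.const_mul g⁻¹
      · rw [← range_comp]; simp [Function.comp_def]
  inv := by
    rintro D ⟨d, y, p, hy, hp, rfl | rfl⟩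
    · exact ⟨d, y, p, hy, hp, Or.inr (by rw [← range_comp]; rfl)⟩
    · exact ⟨d, y, p, hy, hp, Or.inl (by rw [← range_comp]; simp [Function.comp_def])⟩

/-- Take `z = y * p⁻¹ = d⁻¹ * (d * y * p⁻¹)` along indices whose term is in `B`: the first factor or
its inverse is in `B`, the second tends to 1. -/
theorem exists_escapes_of_subset (hN : IsCapturingSequence N) {D B : Set G}
    (hD : D ∈ compensatedFamily N) (hBD : B ⊆ D) (hB : B.Infinite) :
    ∃ z : ℕ → G, Escapes N z ∧ ∀ V ∈ 𝓝 (1 : G), (B \ V).Finite →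
      ∀ᶠ l in atTop, ∃ a ∈ V, ∃ b ∈ V, z l = a⁻¹ * b ∨ z l = a * b := by
  obtain ⟨d, y, p, hy, hp, hDd⟩ := hD
  obtain ⟨e, he, hfib, hed⟩ : ∃ e : ℕ → G, D = range e ∧ (∀ x, {l | e l = x}.Finite) ∧
      ∀ l, (d l)⁻¹ = (e l)⁻¹ ∨ (d l)⁻¹ = e l := by
    have hfib := hN.finite_fiber_of_tendsto_mul hy hp
    rcases hDd with h | h
    · exact ⟨d, h, hfib, fun l => Or.inl rfl⟩
    · refine ⟨fun l => (d l)⁻¹, h, fun x => (hfib x⁻¹).subset fun l hl => ?_, fun l => Or.inr rfl⟩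
      exact inv_eq_iff_eq_inv.1 hl
  have hinf : {l | e l ∈ B}.Infinite := by
    intro hfin
    refine hB ((hfin.image e).subset fun b hb => ?_)
    obtain ⟨l, rfl⟩ := he ▸ hBD hb
    exact ⟨l, hb, rfl⟩
  obtain ⟨φ, hφ, hφB⟩ := extraction_of_frequently_atTop (Nat.frequently_atTop_iff_infinite.2 hinf)
  refine ⟨fun l => y (φ l) * p⁻¹, hN.escapes_mul_right (hy.comp hφ.injective) p⁻¹, ?_⟩
  intro V hV hBV
  have h₁ : ∀ᶠ l in atTop, e (φ l) ∈ V := by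
    rw [← Nat.cofinite_eq_atTop]
    refine ((finite_preimage_of_finite_fibers hfib hBV).preimage hφ.injective.injOn).subset ?_
    exact fun l hl => ⟨hφB l, hl⟩
  have h₂ : ∀ᶠ l in atTop, d (φ l) * y (φ l) * p⁻¹ ∈ V := by
    have := (hp.comp hφ.tendsto_atTop).mul_const p⁻¹
    rw [mul_inv_cancel] at this
    exact this.eventually hV
  filter_upwards [h₁, h₂] with l hl₁ hl₂
  refine ⟨_, hl₁, _, hl₂, ?_⟩
  rcases hed (φ l) with h | h
  · left; rw [← h]; group
  · right; rw [← h]; group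

/-- No countable family of infinite sets of compensated terms accumulates at the identity. -/
theorem not_network_compensatedFamily [T1Space G] [SequentialSpace G]
    (hN : IsCapturingSequence N) {B : ℕ → Set G} (hinf : ∀ n, (B n).Infinite)
    (hB : ∀ n, ∃ D ∈ compensatedFamily N, B n ⊆ D) :
    ¬ ∀ U : Set G, IsOpen U → U.Nonempty → ∃ n, (B n \ U).Finite := by
  intro hnet
  have hz := fun n => (hB n).elim fun D hD => hN.exists_escapes_of_subset hD.1 hD.2 (hinf n)
  choose z hz hzV using hz
  -- Cutting `N n` out of the `n`-th range leaves only finitely many points in each `N k`.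
  set E : Set G := ⋃ n, range (z n) \ N n with hE
  have hfin : ∀ k, (E ∩ N k).Finite := by
    intro k
    refine ((finite_lt_nat k).biUnion fun n _ => ((hz n k).image (z n))).subset ?_
    rintro x ⟨hx, hxk⟩
    obtain ⟨n, ⟨l, rfl⟩, hn⟩ := mem_iUnion.1 hx
    refine mem_biUnion (show n < k from ?_) ⟨l, hxk, rfl⟩
    by_contra hkn
    exact hn (hN.monotone (not_lt.1 hkn) hxk)
  have hE' : IsClosed (E \ {1}) := by
    refine NoConvergent.isClosed fun C hC p hp => ?_
    obtain ⟨k, hk⟩ := hN.capture C p hp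
    refine hp.1 ((hk.union (hfin k)).subset fun x hx => ?_)
    by_cases hxk : x ∈ N k
    · exact Or.inr ⟨(hC hx).1, hxk⟩
    · exact Or.inl ⟨hx, hxk⟩
  have hnhds : (E \ {1})ᶜ ∈ 𝓝 (1 : G) := hE'.isOpen_compl.mem_nhds (by simp)
  obtain ⟨V, hV, hVE⟩ := exists_nhds_one_split hnhds
  obtain ⟨n, hn⟩ := hnet (interior (V ∩ V⁻¹)) isOpen_interior
    ⟨1, mem_interior_iff_mem_nhds.2 (inter_mem hV (inv_mem_nhds_one G hV))⟩
  have hev := hzV n _ (interior_mem_nhds.2 (inter_mem hV (inv_mem_nhds_one G hV))) hn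
  have h₁ : ∀ᶠ l in atTop, z n l ∉ N n := by
    rw [← Nat.cofinite_eq_atTop]
    simpa [Filter.eventually_cofinite] using hz n n
  have h₂ : ∀ᶠ l in atTop, z n l ≠ 1 := by
    rw [← Nat.cofinite_eq_atTop]
    simpa [Filter.eventually_cofinite] using hN.finite_fiber (hz n) 1
  obtain ⟨l, ⟨a, ha, b, hb, hab⟩, hl₁, hl₂⟩ := (hev.and (h₁.and h₂)).exists
  have ha' := interior_subset ha
  have hb' := interior_subset hb
  have hmem : z n l ∈ (E \ {1})ᶜ := by
    rcases hab with h | h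
    · rw [h]; exact hVE _ ha'.2 _ hb'.1
    · rw [h]; exact hVE _ ha'.1 _ hb'.1
  exact hmem ⟨mem_iUnion.2 ⟨n, mem_range_self l, hl₁⟩, hl₂⟩

end IsCapturingSequence

end Escaping

/-! ### Networks of closed discrete sets -/

section Networks

variable {G : Type u} [Group G] [TopologicalSpace G] [IsTopologicalGroup G]

/-- A countable `π`-network at the identity modulo finite sets can be refined so that each of its
members is either contained in a given closed set, or has small translates almost disjoint from
it. -/
theorem exists_refined_network [Countable G] {D : ℕ → Set G} (hinf : ∀ n, (D n).Infinite)
    (hD : ∀ n, NoConvergent (D n)) (hnet : ∀ U ∈ 𝓝 (1 : G), ∃ n, (D n \ U).Finite)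
    {S : ℕ → Set G} (hS : Monotone S) :
    ∃ B : ℕ → Set G, (∀ i, (B i).Infinite) ∧ (∀ i, NoConvergent (B i)) ∧
      (∀ i k, B i ⊆ S k ∨ ∀ᶠ x in 𝓝 (1 : G), ((fun b => b * x) '' B i ∩ S k).Finite) ∧
      ∀ U ∈ 𝓝 (1 : G), ∃ i, (B i \ U).Finite := by
  let 𝓑 : Set (Set G) := {B | B.Infinite ∧ NoConvergent B ∧
    (∀ k, B ⊆ S k ∨ ∀ᶠ x in 𝓝 (1 : G), ((fun b => b * x) '' B ∩ S k).Finite) ∧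
    B ∈ range D ∪ range fun q : ℕ × G × ℕ => (fun b => b * q.2.1) '' D q.1 ∩ S q.2.2}
  have hcount : 𝓑.Countable :=
    ((countable_range D).union (countable_range _)).mono fun B hB => hB.2.2.2
  have hnet' : ∀ U ∈ 𝓝 (1 : G), ∃ B ∈ 𝓑, (B \ U).Finite := by
    intro U hU
    obtain ⟨V, hV, hVU⟩ := exists_nhds_one_split hU
    obtain ⟨n, hn⟩ := hnet V hV
    -- If such a `k` exists, take the least one, `κ`, and replace `D n` by the trace on `S κ` of a
    -- small translate; minimality handles the smaller indices.
    by_cases hex : ∃ k, ∃ᶠ x in 𝓝 (1 : G), ((fun b => b * x) '' D n ∩ S k).Infinite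
    · classical
      set κ := Nat.find hex with hκ
      have hfreq := Nat.find_spec hex
      have hlt : ∀ᶠ x in 𝓝 (1 : G), ∀ k ∈ {k | k < κ},
          ((fun b => b * x) '' D n ∩ S k).Finite := by
        refine (finite_lt_nat κ).eventually_all.2 fun k hk => ?_
        have := Nat.find_min hex hk
        rw [not_frequently] at this
        exact this.mono fun x hx => not_infinite.1 hx
      obtain ⟨x, hx, hxlt, hxV⟩ := (hfreq.and_eventually (hlt.eventually_nhds.and hV)).exists
      refine ⟨(fun b => b * x) '' D n ∩ S κ, ⟨hx, ?_, fun k => ?_, Or.inr ⟨(n, x, κ), rfl⟩⟩, ?_⟩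
      · exact ((hD n).image (Homeomorph.mulRight x)).mono inter_subset_left
      · rcases le_or_gt κ k with hk | hk
        · exact Or.inl (inter_subset_right.trans (hS hk))
        · right
          have ht : Tendsto (fun x' => x * x') (𝓝 (1 : G)) (𝓝 x) := by
            simpa using (continuous_const_mul x).tendsto (1 : G)
          refine (ht.eventually hxlt).mono fun x' hx' => (hx' k hk).subset ?_
          rintro _ ⟨⟨_, ⟨⟨b, hb, rfl⟩, -⟩, rfl⟩, hk'⟩
          exact ⟨⟨b, hb, (mul_assoc b x x').symm⟩, hk'⟩
      · refine (hn.image fun b => b * x).subset ?_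
        rintro _ ⟨⟨⟨b, hb, rfl⟩, -⟩, hbU⟩
        exact ⟨b, ⟨hb, fun hbV => hbU (hVU b hbV x hxV)⟩, rfl⟩
    · push Not at hex
      refine ⟨D n, ⟨hinf n, hD n, fun k => Or.inr ?_, Or.inl ⟨n, rfl⟩⟩, hn.subset ?_⟩
      · exact hex k
      · refine sdiff_subset_sdiff_right fun v hv => ?_
        simpa using hVU v hv 1 (mem_of_mem_nhds hV)
  obtain ⟨B₀, hB₀, -⟩ := hnet' univ univ_mem
  obtain ⟨B, hB⟩ := hcount.exists_eq_range ⟨B₀, hB₀⟩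
  have hBmem : ∀ i, B i ∈ 𝓑 := fun i => hB ▸ mem_range_self i
  refine ⟨B, fun i => (hBmem i).1, fun i => (hBmem i).2.1, fun i => (hBmem i).2.2.1, ?_⟩
  intro U hU
  obtain ⟨_, hB', hfin⟩ := hnet' U hU
  rw [hB] at hB'
  obtain ⟨i, rfl⟩ := hB'
  exact ⟨i, hfin⟩

/-- Given a set `B` without convergent sequences, every point in the closure of `T` is in the
closure of a subset `Y` of `T` for which the translates of `Y` by points of `B` are locally
finite. -/
theorem exists_subset_locallyFinite_translates [T1Space G] [Countable G] [SequentialSpace G]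
    {B T : Set G} (hB : NoConvergent B) {x : G} (hx : x ∈ closure T) :
    ∃ Y ⊆ T, x ∈ closure Y ∧ ∀ p, ∃ P ∈ 𝓝 p, {b ∈ B | ∃ y ∈ Y, b * y ∈ P}.Finite := by
  let small : G → Set G → Prop := fun p Y => ∃ P ∈ 𝓝 p, {b ∈ B | ∃ y ∈ Y, b * y ∈ P}.Finite
  have small_mono : ∀ p Y Y', Y ⊆ Y' → small p Y' → small p Y := by
    rintro p Y Y' hY ⟨P, hP, hfin⟩
    exact ⟨P, hP, hfin.subset fun b hb => ⟨hb.1, hb.2.imp fun y hy => ⟨hY hy.1, hy.2⟩⟩⟩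
  have small_union : ∀ p Y Y', small p Y → small p Y' → small p (Y ∪ Y') := by
    rintro p Y Y' ⟨P, hP, hfin⟩ ⟨P', hP', hfin'⟩
    refine ⟨P ∩ P', inter_mem hP hP', (hfin.union hfin').subset ?_⟩
    rintro b ⟨hb, y, hy | hy, hyP⟩
    · exact Or.inl ⟨hb, y, hy, hyP.1⟩
    · exact Or.inr ⟨hb, y, hy, hyP.2⟩
  have small_empty : ∀ p, small p ∅ := fun p => ⟨univ, univ_mem, by simp⟩
  have small_nhds : ∀ p z, ∃ O, IsOpen O ∧ z ∈ O ∧ small p O := by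
    intro p z
    obtain ⟨Q, hQ, hfin⟩ := hB.exists_nhds_inter_finite (p * z⁻¹)
    have hcont : Tendsto (fun q : G × G => q.1 * q.2⁻¹) (𝓝 p ×ˢ 𝓝 z) (𝓝 (p * z⁻¹)) :=
      tendsto_fst.mul tendsto_snd.inv
    obtain ⟨P, hP, O, hO, hPO⟩ := mem_prod_iff.1 (hcont hQ)
    refine ⟨interior O, isOpen_interior, mem_interior_iff_mem_nhds.2 hO, P, hP, hfin.subset ?_⟩
    rintro b ⟨hb, y, hy, hbP⟩
    refine ⟨hb, ?_⟩
    have := hPO (show (b * y, y) ∈ P ×ˢ O from ⟨hbP, interior_subset hy⟩)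
    simpa using this
  let Z : Set G := {x | ∃ Y ⊆ T, x ∈ closure Y ∧ ∀ p, small p Y}
  have hTZ : T ⊆ Z := by
    intro t ht
    refine ⟨{t}, singleton_subset_iff.2 ht, subset_closure rfl, fun p => ?_⟩
    obtain ⟨O, -, htO, hO⟩ := small_nhds p t
    exact small_mono p _ _ (singleton_subset_iff.2 htO) hO
  have hZ : IsClosed Z := by
    refine IsSeqClosed.isClosed fun x q hx hq => ?_
    choose Y hYT hYx hY using hx
    choose O hOo hqO hO using fun p => small_nhds p q
    obtain ⟨g, hg⟩ := exists_surjective_nat G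
    -- With `G` enumerated by `g`, `W i` meets the first requirements at stage `i`. For each `p`,
    -- all but finitely many pieces then lie in `O p`, the rest being a finite union of small sets.
    let W : ℕ → Set G := fun i => ⋂ m ∈ {m | m ≤ i ∧ x i ∈ O (g m)}, O (g m)
    have hW : ∀ i, W i ∈ 𝓝 (x i) := fun i =>
      (biInter_mem ((finite_le_nat i).subset fun m hm => hm.1)).2 fun m hm =>
        (hOo _).mem_nhds hm.2
    refine ⟨⋃ i, Y i ∩ W i, iUnion_subset fun i => inter_subset_left.trans (hYT i), ?_, ?_⟩
    · refine isClosed_closure.mem_of_tendsto hq (Eventually.of_forall fun i => ?_)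
      refine closure_mono (subset_iUnion (fun i => Y i ∩ W i) i) ?_
      rw [mem_closure_iff_nhds]
      intro U hU
      obtain ⟨y, ⟨hyU, hyW⟩, hy⟩ := mem_closure_iff_nhds.1 (hYx i) _ (inter_mem hU (hW i))
      exact ⟨y, hyU, hy, hyW⟩
    · intro p
      obtain ⟨m, rfl⟩ := hg p
      obtain ⟨i₀, hi₀⟩ := eventually_atTop.1 (hq.eventually ((hOo (g m)).mem_nhds (hqO (g m))))
      have hinit : ∀ j, small (g m) (⋃ i ∈ {i | i < j}, Y i ∩ W i) := by
        intro j
        induction j with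
        | zero => simpa using small_empty (g m)
        | succ j ih =>
          refine small_mono _ _ _ ?_ (small_union _ _ _ ih (hY j (g m)))
          refine iUnion₂_subset fun i hi => ?_
          rcases Nat.lt_succ_iff_lt_or_eq.1 hi with h | rfl
          · exact fun y hy => Or.inl (mem_biUnion h hy)
          · exact inter_subset_left.trans subset_union_right
      refine small_mono _ _ _ ?_ (small_union _ _ _ (hinit (max i₀ m)) (hO (g m)))
      refine iUnion_subset fun i => ?_
      rcases lt_or_ge i (max i₀ m) with h | h
      · exact fun y hy => Or.inl (mem_biUnion h hy)
      · rintro y ⟨-, hy⟩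
        exact Or.inr (mem_iInter₂.1 hy m
          ⟨(le_max_right _ _).trans h, hi₀ i ((le_max_left _ _).trans h)⟩)
  exact closure_minimal hTZ hZ hx

/-- Near 1, attach to each `y` of a locally finite family one factor from `B`, using each factor for
finitely many `y` only. The products then have no convergent subset. -/
theorem exists_noConvergent_products [T1Space G] [Countable G] [SequentialSpace G]
    {B M Z : Set G} (hinf : B.Infinite) (hB : NoConvergent B) (hM : (1 : G) ∈ closure Mᶜ)
    (h1 : 1 ∈ M) (hZ : ∀ᶠ x in 𝓝 (1 : G), ((fun b => b * x) '' B ∩ Z).Finite) :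
    ∃ A : Set G, NoConvergent A ∧ 1 ∉ A ∧ (∀ a ∈ A, a ∉ Z) ∧
      (∀ a ∈ A, ∃ b ∈ B, ∃ y ∉ M, a = b * y) ∧
      ∀ V ∈ 𝓝 (1 : G), (B \ V).Finite → ∃ a ∈ V, ∃ b ∈ V, a * b ∈ A := by
  have hcl : (1 : G) ∈ closure (Mᶜ ∩ {x | ((fun b => b * x) '' B ∩ Z).Finite}) := by
    rw [mem_closure_iff_nhds]
    intro U hU
    obtain ⟨y, ⟨hyU, hyZ⟩, hy⟩ := mem_closure_iff_nhds.1 hM _ (inter_mem hU hZ)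
    exact ⟨y, hyU, hy, hyZ⟩
  obtain ⟨Y, hYT, h1Y, hY⟩ := exists_subset_locallyFinite_translates hB hcl
  obtain ⟨e, he⟩ := exists_injective_nat G
  let b : ℕ ↪ B := hinf.natEmbedding
  have hbinj : ∀ y : G, Function.Injective fun n => (b n : G) * y := fun y =>
    (mul_left_injective y).comp (Subtype.val_injective.comp b.injective)
  -- The bound `e y ≤ n` makes the choice of factor finite-to-one.
  have hex : ∀ y ∈ Y, ∃ n, e y ≤ n ∧ (b n : G) * y ∉ Z ∧ (b n : G) * y ≠ 1 := by
    intro y hy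
    have hfin : {n | (b n : G) * y ∈ ((fun b => b * y) '' B ∩ Z) ∪ {1}}.Finite :=
      ((hYT hy).2.union (finite_singleton 1)).preimage (hbinj y).injOn
    obtain ⟨n, hn, hen⟩ := hfin.infinite_compl.exists_gt (e y)
    refine ⟨n, hen.le, fun hZ' => hn (Or.inl ⟨⟨b n, (b n).2, rfl⟩, hZ'⟩), fun h => hn (Or.inr h)⟩
  choose! n hen hnZ hn1 using hex
  have hfib : ∀ s : Set G, s.Finite → {y ∈ Y | (b (n y) : G) ∈ s}.Finite := by
    intro s hs
    have h₁ : {m | (b m : G) ∈ s}.Finite :=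
      hs.preimage (Subtype.val_injective.comp b.injective).injOn
    obtain ⟨k, hk⟩ := h₁.bddAbove
    refine ((finite_le_nat k).preimage he.injOn).subset fun y hy => ?_
    exact (hen y hy.1).trans (hk hy.2)
  refine ⟨(fun y => (b (n y) : G) * y) '' Y, ?_, ?_, ?_, ?_, ?_⟩
  · refine noConvergent_of_nhds_inter_finite fun p => ?_
    obtain ⟨P, hP, hfin⟩ := hY p
    refine ⟨P, hP, ((hfib _ hfin).image fun y => (b (n y) : G) * y).subset ?_⟩
    rintro _ ⟨⟨y, hy, rfl⟩, hyP⟩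
    exact ⟨y, ⟨hy, (b (n y)).2, y, hy, hyP⟩, rfl⟩
  · rintro ⟨y, hy, h⟩
    exact hn1 y hy h
  · rintro _ ⟨y, hy, rfl⟩
    exact hnZ y hy
  · rintro _ ⟨y, hy, rfl⟩
    exact ⟨_, (b (n y)).2, y, (hYT hy).1, rfl⟩
  · intro V hV hBV
    have hYV : (Y ∩ V).Infinite := by
      intro hfin
      have hmem : V \ (Y ∩ V) ∈ 𝓝 (1 : G) :=
        inter_mem hV (hfin.isClosed.isOpen_compl.mem_nhds fun h => (hYT h.1).1 h1)
      obtain ⟨y, ⟨hyV, hy'⟩, hy⟩ := mem_closure_iff_nhds.1 h1Y _ hmem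
      exact hy' ⟨hy, hyV⟩
    obtain ⟨y, ⟨hy, hyV⟩, hyb⟩ := (hYV.sdiff (hfib _ hBV)).nonempty
    refine ⟨b (n y), ?_, y, hyV, y, hy, rfl⟩
    by_contra hbV
    exact hyb ⟨hy, (b (n y)).2, hbV⟩

/-- A countable `π`-network at the identity consisting, modulo finite sets, of closed discrete sets
is incompatible with capturing sequences whose members are almost disjoint from all sets of
compensated terms. -/
theorem IsCapturingSequence.false_of_network [T1Space G] [Countable G] [SequentialSpace G]
    (hG : ¬ DiscreteTopology G) {N : ℕ → Set G} (hN : IsCapturingSequence N)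
    {S : ℕ → Set G} (hS : Monotone S)
    (hSD : ∀ k, ∀ D ∈ compensatedFamily N, (S k ∩ D).Finite)
    (hcap : ∀ C x, SeqSetTendsto C x → ∃ k, (C \ S k).Finite)
    {D : ℕ → Set G} (hinf : ∀ n, (D n).Infinite) (hD : ∀ n, NoConvergent (D n))
    (hnet : ∀ U ∈ 𝓝 (1 : G), ∃ n, (D n \ U).Finite) : False := by
  obtain ⟨B, hBinf, hB, hBS, hBnet⟩ := exists_refined_network hinf hD hnet hS
  have hA : ∀ i, ∃ A : Set G, NoConvergent A ∧ 1 ∉ A ∧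
      (∀ a ∈ A, a ∉ ⋃ k ∈ {k | k ≤ i ∧ ¬ B i ⊆ S k}, S k) ∧
      (∀ a ∈ A, ∃ b ∈ B i, ∃ y ∉ N i ∪ {1}, a = b * y) ∧
      ∀ V ∈ 𝓝 (1 : G), (B i \ V).Finite → ∃ a ∈ V, ∃ b ∈ V, a * b ∈ A := by
    intro i
    refine exists_noConvergent_products (hBinf i) (hB i) ?_ (Or.inr rfl) ?_
    · have hnwd := (hN.isNowhereDense i).union (isNowhereDense_of_finite hG (finite_singleton 1))
      rw [((hN.isClosed i).union isClosed_singleton).isNowhereDense_iff,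
        interior_eq_empty_iff_dense_compl] at hnwd
      exact hnwd 1
    · have hfin : {k | k ≤ i ∧ ¬ B i ⊆ S k}.Finite := (finite_le_nat i).subset fun k hk => hk.1
      have hall : ∀ᶠ x in 𝓝 (1 : G), ∀ k ∈ {k | k ≤ i ∧ ¬ B i ⊆ S k},
          ((fun b => b * x) '' B i ∩ S k).Finite :=
        hfin.eventually_all.2 fun k hk => (hBS i k).resolve_left hk.2
      refine hall.mono fun x hx => ?_
      rw [inter_iUnion₂]
      exact hfin.biUnion hx
  choose A hAnc hA1 hAS hAB hAnet using hA
  have hE : ¬ IsClosed (⋃ i, A i) := by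
    intro hcl
    have h1 : (1 : G) ∉ ⋃ i, A i := by simpa using hA1
    obtain ⟨V, hV, hVE⟩ := exists_nhds_one_split (hcl.isOpen_compl.mem_nhds h1)
    obtain ⟨i, hi⟩ := hBnet V hV
    obtain ⟨a, ha, b, hb, hab⟩ := hAnet i V hV hi
    exact hVE a ha b hb (mem_iUnion.2 ⟨i, hab⟩)
  obtain ⟨C, hC, p, -, hCp⟩ := exists_seqSetTendsto_of_not_isClosed hE
  obtain ⟨k, hk⟩ := hcap C p hCp
  have hCk : (C ∩ S k).Infinite := by
    have := hCp.1.sdiff hk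
    rwa [sdiff_sdiff_right_self] at this
  have hCk' : SeqSetTendsto (C ∩ S k) p := hCp.mono inter_subset_left hCk
  -- No single `A i` contains infinitely many points of `C`, so points can be taken from ever later
  -- `A i`; their factors `y` therefore escape.
  have hex : ∀ m, ∃ c ∈ C ∩ S k, c ∉ ⋃ i ∈ {i | i < m}, A i := by
    intro m
    have hfin : ((C ∩ S k) ∩ ⋃ i ∈ {i | i < m}, A i).Finite := by
      rw [inter_iUnion₂]
      refine (finite_lt_nat m).biUnion fun i _ => ?_
      by_contra hi
      exact hAnc i _ inter_subset_right p (hCk'.mono inter_subset_left hi)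
    obtain ⟨c, hc, hc'⟩ := (hCk.sdiff hfin).nonempty
    exact ⟨c, hc, fun h => hc' ⟨hc, h⟩⟩
  choose c hcC hcA using hex
  have hidx : ∀ m, ∃ i, m ≤ i ∧ c m ∈ A i := fun m => by
    obtain ⟨i, hi⟩ := mem_iUnion.1 (hC (hcC m).1)
    refine ⟨i, ?_, hi⟩
    by_contra h
    exact hcA m (mem_biUnion (show i < m from not_le.1 h) hi)
  choose i hmi hci using hidx
  choose b hb y hy hby using fun m => hAB (i m) (c m) (hci m)
  have hesc : Escapes N y := fun j => (finite_lt_nat j).subset fun m hm => by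
    by_contra hjm
    exact hy m (Or.inl (hN.monotone ((not_lt.1 hjm).trans (hmi m)) hm))
  have hcfib : ∀ x, {m | c m = x}.Finite := by
    intro x
    by_cases hx : ∃ j, x ∈ A j
    · obtain ⟨j, hj⟩ := hx
      refine (finite_le_nat j).subset fun m hm => ?_
      by_contra hjm
      have hm' : c m = x := hm
      exact hcA m (mem_biUnion (show j < m from not_le.1 hjm) (hm' ▸ hj))
    · refine finite_empty.subset fun m hm => hx ⟨i m, ?_⟩
      have hm' : c m = x := hm
      exact hm' ▸ hci m
  have hlim : Tendsto (fun m => b m * y m) atTop (𝓝 p) := by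
    simp only [← hby]
    intro U hU
    rw [mem_map, ← Nat.cofinite_eq_atTop, mem_cofinite]
    refine (finite_preimage_of_finite_fibers hcfib (hCk'.2 U hU)).subset fun m hm => ?_
    exact ⟨hcC m, hm⟩
  have hbfin := finite_preimage_of_finite_fibers (hN.finite_fiber_of_tendsto_mul hesc hlim)
    (hSD k (range b) ⟨b, y, p, hesc, hlim, Or.inl rfl⟩)
  -- For `m ≥ k` the product `c m` lies in `S k`, which `A (i m)` avoids unless `B (i m) ⊆ S k`;
  -- hence `b m ∈ S k`.
  refine infinite_univ ((hbfin.union (finite_lt_nat k)).subset fun m _ => ?_)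
  rcases lt_or_ge m k with hm | hm
  · exact Or.inr hm
  · refine Or.inl ⟨?_, mem_range_self m⟩
    by_contra hbk
    refine hAS (i m) (c m) (hci m) (mem_biUnion ⟨hm.trans (hmi m), fun h => ?_⟩ (hcC m).2)
    exact hbk (h (hb m))

end Networks

/-! ### Combining the three dichotomies -/

theorem mainTheorem2 (hIIA : InvariantIdealAxiom.{u})
    (G : Type u) [Group G] [TopologicalSpace G] [IsTopologicalGroup G] [T1Space G]
    [Countable G] [SequentialSpace G] :
    TopologicalSpace.MetrizableSpace G ∨ IsKOmega G := by
  by_cases hG : DiscreteTopology G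
  · exact Or.inl inferInstance
  rcases metrizableSpace_or_exists_capturing_isNowhereDense hIIA hG with h | ⟨𝒮, hc, hS, hcap⟩
  · exact Or.inl h
  right
  obtain ⟨N, hN⟩ := exists_isCapturingSequence hG hc hS hcap
  have hinv : IsInvariantFamily {D : Set G | D.Infinite ∧ NoConvergent D} :=
    { mul_left := fun D hD g => ⟨hD.1.image (mul_right_injective g).injOn,
        hD.2.image (Homeomorph.mulLeft g)⟩
      mul_right := fun D hD g => ⟨hD.1.image (mul_left_injective g).injOn,
        hD.2.image (Homeomorph.mulRight g)⟩
      inv := fun D hD => ⟨hD.1.image inv_injective.injOn, hD.2.image (Homeomorph.inv G)⟩ }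
  rcases hinv.dichotomy hIIA hG with ⟨K, -, hclosed, hK, hcapK⟩ | ⟨D, hDinf, hD, hnet⟩
  · exact isKOmega_of_capturing_compact (fun k => isCompact_of_inter_noConvergent_finite (hclosed k)
      fun D hD hD' => hK k D ⟨hD, hD'⟩) hclosed hcapK
  · exfalso
    rcases hN.isInvariantFamily.dichotomy hIIA hG with ⟨S, hS, -, hSD, hcapS⟩ | ⟨B, hB, hB', hBnet⟩
    · refine hN.false_of_network hG hS hSD hcapS hDinf
        (fun n => (hD n).elim fun D' hD' => hD'.1.2.mono hD'.2) fun U hU => ?_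
      obtain ⟨n, hn⟩ := hnet (interior U) isOpen_interior ⟨1, mem_interior_iff_mem_nhds.2 hU⟩
      exact ⟨n, hn.subset (sdiff_subset_sdiff_right interior_subset)⟩
    · exact hN.not_network_compensatedFamily hB hB' hBnet
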